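/- Let $n\ge 1$. For $0<\alpha<n$ let $K_\alpha:\mathbb{R}^n\to\mathbb{R}$ be a locally integrable function that defines a tempered distribution (again denoted $K_\alpha$), and suppose that its distributional Fourier transform $\widehat K_\alpha$ (normalised by $\widehat\varphi(\xi)=\int_{\mathbb{R}^n} e^{-i x\cdot\xi}\varphi(x)\,dx$) is a locally integrable real-valued function, with a given value $\widehat K_\alpha(x)\in\mathbb{R}$ for each $x\neq 0$. For Schwartz functions $f$ on $\mathbb{R}^n$ put $J^\alpha f=K_\alpha * f$, that is, $J^\alpha f(x)=\langle K_\alpha, f(x-\cdot)\rangle$. Suppose: 1. (Identity) for some $0<\alpha_0<n$, $\widehat K_{\alpha_0}(x)=1/|x|^{\alpha_0}$ for all $x\ne 0$; 2. (Index law) $J^{\alpha+\beta}f=J^\alpha(J^\beta f)$ for every Schwartz function $f$ and all $\alpha,\beta\in(0,n)$ with $\alpha+\beta<n$, where $J^\alpha(J^\beta f)=K_\alpha*(J^\beta f)$ is a convolution in the sense of distributions: for every $\varphi\in C_c^\infty(\mathbb{R}^n)$ the function $y\mapsto (J^\beta f)(y)\int K_\alpha(x-y)\varphi(x)\,dx$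 is integrable and its integral is $\int (J^{\alpha+\beta}f)\,\varphi$ (with $(J^{\alpha+\beta}f)\varphi$ integrable); 3. (Continuity) for every $x\neq 0$ the map $\alpha\mapsto \widehat K_\alpha(x)$ from $(0,n)$ to $\mathbb{R}$ is continuous at at least one point (which may depend on $x$). Then $J^\alpha$ is the Riesz potential on the Schwartz space for every $\alpha\in(0,n)$: for every Schwartz function $f$ and every $x\in\mathbb{R}^n$, $$J^\alpha f(x)=\frac{\Gamma\left(\frac{n-\alpha}{2}\right)}{\pi^{n/2}\,2^{\alpha}\,\Gamma\left(\frac{\alpha}{2}\right)}\int_{\mathbb{R}^n}\frac{f(y)}{|x-y|^{n-\alpha}}\,dy,$$ where the integral converges absolutely. -/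

import Mathlib

open MeasureTheory
open scoped SchwartzMap FourierTransform InnerProductSpace

noncomputable section

namespace RieszChar

variable {n : ℕ}

/-- The locally integrable function `u` defines the tempered distribution `T`: as distributions
on `ℝⁿ` (that is, tested against smooth compactly supported functions) they coincide.  As these
test functions are dense in the Schwartz space, `T` is determined by `u`, and `u` is determined
by `T` up to a null set. -/
def IsGivenBy (T : 𝓢'(EuclideanSpace ℝ (Fin n), ℂ)) (u : EuclideanSpace ℝ (Fin n) → ℝ) : Prop :=
  LocallyIntegrable u volume ∧
    ∀ φ : 𝓢(EuclideanSpace ℝ (Fin n), ℂ), HasCompactSupport φ → T φ = ∫ x, (u x : ℂ) * φ x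

/-- The dilation `ξ ↦ ξ / (2π)`. -/
def scale : EuclideanSpace ℝ (Fin n) ≃L[ℝ] EuclideanSpace ℝ (Fin n) :=
  ContinuousLinearEquiv.smulLeft (Units.mk0 ((2 * Real.pi)⁻¹ : ℝ) (by positivity))

/-- The Fourier transform `φ̂(ξ) = ∫ e^{-i⟪x, ξ⟫} φ(x) dx` on the Schwartz space. -/
def hatS : 𝓢(EuclideanSpace ℝ (Fin n), ℂ) →L[ℂ] 𝓢(EuclideanSpace ℝ (Fin n), ℂ) :=
  (SchwartzMap.compCLMOfContinuousLinearEquiv ℂ scale).comp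
    (FourierTransform.fourierCLM ℂ 𝓢(EuclideanSpace ℝ (Fin n), ℂ))

theorem hatS_apply (φ : 𝓢(EuclideanSpace ℝ (Fin n), ℂ)) (ξ : EuclideanSpace ℝ (Fin n)) :
    hatS φ ξ = ∫ x, Complex.exp (-(⟪x, ξ⟫_ℝ : ℂ) * Complex.I) * φ x := by
  have h : hatS φ ξ = 𝓕 (φ : EuclideanSpace ℝ (Fin n) → ℂ) ((2 * Real.pi)⁻¹ • ξ) := rfl
  rw [h, Real.fourier_eq']
  refine integral_congr_ae (Filter.Eventually.of_forall fun x => ?_)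
  have hpi : (Real.pi : ℂ) ≠ 0 := by exact_mod_cast Real.pi_ne_zero
  simp only [smul_eq_mul, inner_smul_right]
  congr 2
  push_cast
  field_simp

/-- The Fourier transform of a tempered distribution: `⟨T̂, φ⟩ = ⟨T, φ̂⟩`. -/
def hat (T : 𝓢'(EuclideanSpace ℝ (Fin n), ℂ)) : 𝓢'(EuclideanSpace ℝ (Fin n), ℂ) :=
  PointwiseConvergenceCLM.precomp ℂ hatS T

theorem hat_apply (T : 𝓢'(EuclideanSpace ℝ (Fin n), ℂ)) (φ : 𝓢(EuclideanSpace ℝ (Fin n), ℂ)) :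
    hat T φ = T (hatS φ) := rfl

/-- The Schwartz function `y ↦ f (x - y)`. -/
def reflectAt (f : 𝓢(EuclideanSpace ℝ (Fin n), ℂ)) (x : EuclideanSpace ℝ (Fin n)) :
    𝓢(EuclideanSpace ℝ (Fin n), ℂ) :=
  SchwartzMap.compSubConstCLM ℂ x
    (SchwartzMap.compCLMOfContinuousLinearEquiv ℂ (ContinuousLinearEquiv.neg ℝ) f)

theorem reflectAt_apply (f : 𝓢(EuclideanSpace ℝ (Fin n), ℂ)) (x y : EuclideanSpace ℝ (Fin n)) :
    reflectAt f x y = f (x - y) := by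
  have h : reflectAt f x y = f (-(y - x)) := rfl
  rw [h, neg_sub]

/-- The convolution `T ∗ f` of a tempered distribution and a Schwartz function, as the function
`x ↦ ⟨T, f (x - ·)⟩`. -/
def conv (T : 𝓢'(EuclideanSpace ℝ (Fin n), ℂ)) (f : 𝓢(EuclideanSpace ℝ (Fin n), ℂ)) :
    EuclideanSpace ℝ (Fin n) → ℂ :=
  fun x => T (reflectAt f x)

/-- `K ∗ g = h` in the sense of distributions, for a locally integrable function `K` and
functions `g`, `h`: for every smooth compactly supported `φ`, the function `g · (Ǩ ∗ φ)`, where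
`(Ǩ ∗ φ) y = ∫ K (x - y) φ x dx`, is integrable, and `∫ g · (Ǩ ∗ φ) = ∫ h · φ`.
If the convolution integrals `∫ |K (x - y)| |g y| dy` are locally integrable in `x`, this says (by
Fubini) that `h x = ∫ K (x - y) g y dy` for almost every `x`. -/
def IsConvolution (K : EuclideanSpace ℝ (Fin n) → ℝ) (g h : EuclideanSpace ℝ (Fin n) → ℂ) : Prop :=
  ∀ φ : 𝓢(EuclideanSpace ℝ (Fin n), ℂ), HasCompactSupport φ →
    Integrable (fun y => g y * ∫ x, (K (x - y) : ℂ) * φ x) volume ∧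
    Integrable (fun x => h x * φ x) volume ∧
    ∫ y, g y * ∫ x, (K (x - y) : ℂ) * φ x = ∫ x, h x * φ x

/-- The normalizing constant `γₙ(α) = π^{n/2} 2^α Γ(α/2) / Γ((n-α)/2)`. -/
def rieszConst (n : ℕ) (α : ℝ) : ℝ :=
  Real.pi ^ ((n : ℝ) / 2) * 2 ^ α * Real.Gamma (α / 2) / Real.Gamma (((n : ℝ) - α) / 2)

/-- The Riesz potential `(1 / γₙ(α)) ∫ f(y) / |x - y|^{n - α} dy` of order `0 < α < n`. -/
def rieszPotential (α : ℝ) (f : EuclideanSpace ℝ (Fin n) → ℂ) (x : EuclideanSpace ℝ (Fin n)) : ℂ :=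
  ((rieszConst n α)⁻¹ : ℝ) * ∫ y, f y / ((‖x - y‖ ^ ((n : ℝ) - α) : ℝ) : ℂ)

end RieszChar

end

/-! On the Fourier side the index law should read `R (α + β) = R α * R β`. This is not immediate,
since `K_β * f` is no Schwartz function and its convolution with `K_α` is only assumed to exist
weakly. The way in is the integrability clause of the law with `β = α`, tested against the conjugate
of `f`. Because `K_α` is real with real transform, it is even (`IsGivenBy.map_negS`), and the
integrand then has modulus `|K_α * f|²`. Hence `K_α * f` lies in `L²` for `α < n / 2` and compactly
supported `f` (`IsGivenBy.memLp_conv`). Plancherel now applies and yields `R (α + β) = R α * R β`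
almost everywhere for `α, β < n / 2` (`ae_eq_mul_of_isConvolution`).

For fixed `α` only the countable group `ℚ α₀ + ℚ α` matters, so a single null set is discarded. At
every other `x`, the function `σ a = R a x * ‖x‖ ^ a` is multiplicative on this group, equals `1` at
`α₀`, and is bounded above near the continuity point. The local-boundedness argument for Cauchy's
equation forces `σ = 1` (`eq_one_of_map_add_eq_mul`), so `R α x = ‖x‖ ^ (-α)`.

Writing the power as an integral of Gaussians identifies the distribution with this transform as the
Riesz kernel (`apply_eq_rieszConst_inv_mul_integral`). -/

namespace RieszChar

/-! ### Density of compactly supported functions in the Schwartz space. -/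

section Cutoff

open Filter Topology

variable {E : Type*} [NormedAddCommGroup E] [InnerProductSpace ℝ E] [FiniteDimensional ℝ E]

theorem exists_bound_iteratedFDeriv_bump_sub_one (χ : ContDiffBump (0 : E)) (i : ℕ) :
    ∃ C, ∀ x, ‖iteratedFDeriv ℝ i (fun y => χ y - 1) x‖ ≤ C := by
  have hχ : ContDiff ℝ ((⊤ : ℕ∞) : WithTop ℕ∞) χ := χ.contDiff
  let g : 𝓢(E, ℝ) := χ.hasCompactSupport.toSchwartzMap hχ
  refine ⟨SchwartzMap.seminorm ℝ 0 i g + 1, fun x => ?_⟩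
  have h1 : iteratedFDeriv ℝ i (fun y => χ y - 1) x
      = iteratedFDeriv ℝ i χ x - iteratedFDeriv ℝ i (fun _ : E => (1 : ℝ)) x :=
    fun_iteratedFDeriv_sub_apply (hχ.of_le (by exact_mod_cast le_top)).contDiffAt contDiffAt_const
  rw [h1]
  refine (norm_sub_le _ _).trans (add_le_add (g.norm_iteratedFDeriv_le_seminorm ℝ i x) ?_)
  rcases Nat.eq_zero_or_pos i with rfl | hi
  · simp
  · rw [iteratedFDeriv_const_of_ne hi.ne']; simp

/-- Every Schwartz function is the limit, in the Schwartz space, of compactly supported ones which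
it dominates pointwise. -/
theorem exists_seq_hasCompactSupport_tendsto (φ : 𝓢(E, ℂ)) :
    ∃ s : ℕ → 𝓢(E, ℂ), (∀ k, HasCompactSupport (s k)) ∧ Tendsto s atTop (𝓝 φ) ∧
      ∀ k x, ‖s k x‖ ≤ ‖φ x‖ := by
  let χ : ContDiffBump (0 : E) := ⟨1, 2, one_pos, one_lt_two⟩
  have hχ : ContDiff ℝ ((⊤ : ℕ∞) : WithTop ℕ∞) χ := χ.contDiff
  let c : ℕ → ℝ := fun k => ((k : ℝ) + 1)⁻¹
  have hc : ∀ k, 0 < c k := fun k => by positivity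
  have hcs : ∀ k, HasCompactSupport (fun x : E => χ (c k • x)) := fun k =>
    χ.hasCompactSupport.comp_homeomorph (Homeomorph.smulOfNeZero (c k) (hc k).ne')
  have hg : ∀ k, (fun x : E => χ (c k • x)).HasTemperateGrowth := fun k =>
    (hcs k).hasTemperateGrowth (hχ.comp (contDiff_const_smul _))
  let s : ℕ → 𝓢(E, ℂ) := fun k => SchwartzMap.smulLeftCLM ℂ (fun x : E => χ (c k • x)) φ
  have hs : ∀ k x, s k x = χ (c k • x) • φ x := fun k x =>
    SchwartzMap.smulLeftCLM_apply_apply (hg k) φ x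
  refine ⟨s, fun k => ?_, ?_, fun k x => ?_⟩
  · have : (s k : E → ℂ) = fun x => χ (c k • x) • φ x := funext (hs k)
    rw [this]
    exact (hcs k).smul_right
  · rw [(schwartz_withSeminorms ℝ E ℂ).tendsto_nhds]
    rintro ⟨m, l⟩ ε hε
    choose C hC using exists_bound_iteratedFDeriv_bump_sub_one χ
    have hC0 : ∀ i, 0 ≤ C i := fun i => (norm_nonneg _).trans (hC i 0)
    let M : ℝ := ∑ i ∈ Finset.range (l + 1), (l.choose i : ℝ) * C i *
      SchwartzMap.seminorm ℝ (m + 1) (l - i) φ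
    have hM : 0 ≤ M := Finset.sum_nonneg fun i _ =>
      mul_nonneg (mul_nonneg (by positivity) (hC0 i)) (apply_nonneg _ _)
    have key : ∀ k, SchwartzMap.seminorm ℝ m l (s k - φ) ≤ c k * M := by
      intro k
      refine SchwartzMap.seminorm_le_bound ℝ m l _ (mul_nonneg (hc k).le hM) fun x => ?_
      have hfun : ((s k - φ : 𝓢(E, ℂ)) : E → ℂ) = fun y => (χ (c k • y) - 1) • φ y := by
        funext y
        simp [hs, sub_smul]
      rw [hfun]
      -- Near such `x` the cutoff is identically `1` and the difference vanishes. Elsewhere `1 ≤ c k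
      -- * ‖x‖`, so one more power of `‖x‖` in the seminorm buys the decaying factor `c k`.
      by_cases hx : c k * ‖x‖ < 1
      · have hloc : (fun y => (χ (c k • y) - 1) • φ y) =ᶠ[𝓝 x] fun _ => 0 := by
          have : ∀ᶠ y in 𝓝 x, c k * ‖y‖ < 1 :=
            (continuous_const.mul continuous_norm).continuousAt.eventually_lt_const hx
          filter_upwards [this] with y hy
          rw [χ.one_of_mem_closedBall, sub_self, zero_smul]
          rw [mem_closedBall_zero_iff, norm_smul, Real.norm_of_nonneg (hc k).le]
          exact hy.le
        rw [(hloc.iteratedFDeriv ℝ l).eq_of_nhds]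
        simp [mul_nonneg (hc k).le hM]
      · push Not at hx
        have hsm : ContDiff ℝ ((⊤ : ℕ∞) : WithTop ℕ∞) (fun y => χ (c k • y) - 1) :=
          (hχ.comp (contDiff_const_smul _)).sub contDiff_const
        have h1 := norm_iteratedFDeriv_smul_le (𝕜 := ℝ) (n := l) hsm (φ.smooth ⊤) x
          (by exact_mod_cast le_top)
        calc ‖x‖ ^ m * ‖iteratedFDeriv ℝ l (fun y => (χ (c k • y) - 1) • φ y) x‖
            ≤ ‖x‖ ^ m * ∑ i ∈ Finset.range (l + 1), (l.choose i : ℝ) *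
              ‖iteratedFDeriv ℝ i (fun y => χ (c k • y) - 1) x‖ *
              ‖iteratedFDeriv ℝ (l - i) φ x‖ := by gcongr
          _ ≤ c k * M := by
            rw [Finset.mul_sum, Finset.mul_sum]
            refine Finset.sum_le_sum fun i _ => ?_
            have h2 : ‖iteratedFDeriv ℝ i (fun y => χ (c k • y) - 1) x‖ ≤ C i := by
              have := congrFun (iteratedFDeriv_comp_const_smul (𝕜 := ℝ) (i := i)
                (f := fun y : E => χ y - 1) (c k)
                ((hχ.sub contDiff_const).of_le (by exact_mod_cast le_top))) x
              rw [this, norm_smul, norm_pow, Real.norm_of_nonneg (hc k).le]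
              have hck : c k ≤ 1 := inv_le_one_of_one_le₀ (by simp)
              calc _ ≤ 1 * C i := by
                    gcongr
                    · exact pow_le_one₀ (hc k).le hck
                    · exact hC i _
                _ = C i := one_mul _
            have h3 := φ.le_seminorm ℝ (m + 1) (l - i) x
            have h4 : ‖x‖ ^ m * ‖iteratedFDeriv ℝ (l - i) φ x‖ ≤
                c k * SchwartzMap.seminorm ℝ (m + 1) (l - i) φ := by
              calc _ ≤ (c k * ‖x‖) * (‖x‖ ^ m * ‖iteratedFDeriv ℝ (l - i) φ x‖) :=
                    le_mul_of_one_le_left (by positivity) hx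
                _ = c k * (‖x‖ ^ (m + 1) * ‖iteratedFDeriv ℝ (l - i) φ x‖) := by ring
                _ ≤ _ := mul_le_mul_of_nonneg_left h3 (hc k).le
            calc _ = (l.choose i : ℝ) * ‖iteratedFDeriv ℝ i (fun y => χ (c k • y) - 1) x‖ *
                  (‖x‖ ^ m * ‖iteratedFDeriv ℝ (l - i) φ x‖) := by ring
              _ ≤ (l.choose i : ℝ) * C i *
                  (c k * SchwartzMap.seminorm ℝ (m + 1) (l - i) φ) := by
                have := hC0 i
                gcongr
              _ = _ := by ring
    have hlim : Tendsto (fun k => c k * M) atTop (𝓝 0) := by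
      simpa [c] using (tendsto_one_div_add_atTop_nhds_zero_nat (𝕜 := ℝ)).mul_const M
    filter_upwards [hlim.eventually_lt_const hε] with k hk
    exact (key k).trans_lt hk
  · rw [hs, norm_smul, Real.norm_of_nonneg χ.nonneg]
    exact mul_le_of_le_one_left (norm_nonneg _) χ.le_one

theorem dense_hasCompactSupport : Dense {φ : 𝓢(E, ℂ) | HasCompactSupport φ} := fun φ => by
  obtain ⟨s, h1, h2, -⟩ := exists_seq_hasCompactSupport_tendsto φ
  exact mem_closure_of_tendsto h2 (Eventually.of_forall h1)

variable [MeasurableSpace E] [BorelSpace E]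

/-- A continuous functional on the Schwartz space which is integration against `u` on compactly
supported functions is integration against `u` on every `φ` with `u φ` integrable. -/
theorem apply_eq_integral_of_integrable {L : 𝓢(E, ℂ) → ℂ} (hL : Continuous L) {u : E → ℂ}
    (hu : AEStronglyMeasurable u volume)
    (h : ∀ φ : 𝓢(E, ℂ), HasCompactSupport φ → L φ = ∫ x, u x * φ x) (φ : 𝓢(E, ℂ))
    (hφ : Integrable fun x => u x * φ x) : L φ = ∫ x, u x * φ x := by
  obtain ⟨s, h1, h2, h3⟩ := exists_seq_hasCompactSupport_tendsto φ
  have hp : ∀ x, Tendsto (fun k => s k x) atTop (𝓝 (φ x)) := fun x =>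
    ((TemperedDistribution.delta x).continuous.tendsto φ).comp h2
  refine tendsto_nhds_unique ((hL.tendsto φ).comp h2) ?_
  have : (L ∘ s) = fun k => ∫ x, u x * s k x := funext fun k => h _ (h1 k)
  rw [this]
  refine tendsto_integral_of_dominated_convergence (fun x => ‖u x * φ x‖)
    (fun k => hu.mul (s k).continuous.aestronglyMeasurable) hφ.norm
    (fun k => Eventually.of_forall fun x => ?_)
    (Eventually.of_forall fun x => (hp x).const_mul _)
  rw [norm_mul, norm_mul]
  gcongr
  exact h3 k x

/-- Locally integrable functions with the same integrals against compactly supported Schwartz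
functions agree almost everywhere. -/
theorem ae_eq_of_integral_mul_eq {u v : E → ℂ} (hu : LocallyIntegrable u volume)
    (hv : LocallyIntegrable v volume)
    (h : ∀ φ : 𝓢(E, ℂ), HasCompactSupport φ → ∫ x, u x * φ x = ∫ x, v x * φ x) :
    u =ᵐ[volume] v := by
  refine ae_eq_of_integral_contDiff_smul_eq hu hv fun g hg hgs => ?_
  have hcs : HasCompactSupport (fun x => (g x : ℂ)) := hgs.comp_left Complex.ofReal_zero
  have hsm : ContDiff ℝ ((⊤ : ℕ∞) : WithTop ℕ∞) (fun x => (g x : ℂ)) :=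
    Complex.ofRealCLM.contDiff.comp hg
  have := h (hcs.toSchwartzMap hsm) hcs
  change ∫ x, u x * (g x : ℂ) = ∫ x, v x * (g x : ℂ) at this
  simpa only [Complex.real_smul, mul_comm] using this

end Cutoff

/-! ### Normalizations, conjugation, and evenness of the kernels. -/

section Symmetry

open Filter Topology

variable {n : ℕ}

local notation "E" => EuclideanSpace ℝ (Fin n)

theorem locallyIntegrable_comp_smul {u : E → ℝ} (hu : LocallyIntegrable u volume) {c : ℝ}
    (hc : c ≠ 0) : LocallyIntegrable (fun x => u (c • x)) volume := by
  rw [locallyIntegrable_iff] at hu ⊢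
  intro k hk
  let m : E ≃ₜ E := Homeomorph.smulOfNeZero c hc
  have h1 : IntegrableOn u (m '' k) (Measure.map m volume) := by
    have : Measure.map m (volume : Measure E)
        = ENNReal.ofReal (abs (c ^ Module.finrank ℝ E)⁻¹) • volume :=
      Measure.map_addHaar_smul volume hc
    rw [this]
    rw [IntegrableOn, Measure.restrict_smul]
    exact (hu _ (hk.image m.continuous)).smul_measure ENNReal.ofReal_ne_top
  rw [m.measurableEmbedding.integrableOn_map_iff, m.injective.preimage_image] at h1
  exact h1

/-- The normalization `𝓕` of the Fourier transform of `T` is given by `ξ ↦ T̂ (2π ξ)`. -/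
theorem isGivenBy_fourier {T : 𝓢'(E, ℂ)} {R : E → ℝ} (h : IsGivenBy (hat T) R) :
    IsGivenBy (𝓕 T) fun ξ => R ((2 * Real.pi) • ξ) := by
  have hpi : (2 * Real.pi) ≠ 0 := by positivity
  refine ⟨locallyIntegrable_comp_smul h.1 hpi, fun φ hφ => ?_⟩
  let ψ : 𝓢(E, ℂ) := SchwartzMap.compCLMOfContinuousLinearEquiv ℂ scale φ
  have hψ : ∀ x, ψ x = φ ((2 * Real.pi)⁻¹ • x) := fun x => rfl
  have hψs : HasCompactSupport ψ := hφ.comp_homeomorph (scale (n := n)).toHomeomorph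
  let c : ℝ := |((2 * Real.pi) ^ Module.finrank ℝ E)⁻¹|
  have hc : ∀ f : E → ℂ, ∫ x, f ((2 * Real.pi) • x) = c • ∫ x, f x :=
    fun f => Measure.integral_comp_smul volume f _
  have h1 : (c : ℂ) • hatS ψ = 𝓕 φ := by
    ext ξ
    change (c : ℂ) • 𝓕 (ψ : E → ℂ) ((2 * Real.pi)⁻¹ • ξ) = 𝓕 (φ : E → ℂ) ξ
    rw [Real.fourier_eq, Real.fourier_eq]
    have := hc fun v => Real.fourierChar (-⟪v, (2 * Real.pi)⁻¹ • ξ⟫_ℝ) • ψ v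
    rw [Complex.coe_smul, ← this]
    refine integral_congr_ae (Eventually.of_forall fun v => ?_)
    simp only [hψ, inner_smul_left, inner_smul_right, smul_smul, inv_mul_cancel₀ hpi, one_smul]
    congr 3
    simp
    field_simp
  have h2 := h.2 ψ hψs
  rw [hat_apply] at h2
  rw [TemperedDistribution.fourier_apply, ← h1, map_smul, h2]
  have := hc fun x => (R x : ℂ) * ψ x
  simp only [hψ, smul_smul, inv_mul_cancel₀ hpi, one_smul] at this
  rw [this, Complex.real_smul, smul_eq_mul]
  rfl

/-- Complex conjugation on the Schwartz space. -/
noncomputable def conjS : 𝓢(E, ℂ) →L[ℝ] 𝓢(E, ℂ) :=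
  SchwartzMap.postcompCLM (Complex.conjCLE : ℂ →L[ℝ] ℂ)

theorem conjS_apply (φ : 𝓢(E, ℂ)) (x : E) : conjS φ x = starRingEnd ℂ (φ x) := rfl

theorem conjS_conjS (φ : 𝓢(E, ℂ)) : conjS (conjS φ) = φ := by
  ext x; simp [conjS_apply]

/-- The reflection `φ ↦ φ (-·)` of the Schwartz space. -/
noncomputable def negS : 𝓢(E, ℂ) →L[ℂ] 𝓢(E, ℂ) :=
  SchwartzMap.compCLMOfContinuousLinearEquiv ℂ (ContinuousLinearEquiv.neg ℝ)

theorem negS_apply (φ : 𝓢(E, ℂ)) (x : E) : negS φ x = φ (-x) := rfl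

theorem hasCompactSupport_conjS {φ : 𝓢(E, ℂ)} (h : HasCompactSupport φ) :
    HasCompactSupport (conjS φ) :=
  h.comp_left (g := starRingEnd ℂ) (map_zero _)

theorem hasCompactSupport_negS {φ : 𝓢(E, ℂ)} (h : HasCompactSupport φ) :
    HasCompactSupport (negS φ) :=
  h.comp_homeomorph (Homeomorph.neg E)

theorem hasCompactSupport_reflectAt {f : 𝓢(E, ℂ)} (h : HasCompactSupport f) (x : E) :
    HasCompactSupport (reflectAt f x) := by
  have : (reflectAt f x : E → ℂ) = f ∘ Homeomorph.subLeft x := funext fun y => reflectAt_apply f x y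
  rw [this]
  exact h.comp_homeomorph _

theorem fourier_conjS (φ : 𝓢(E, ℂ)) : 𝓕 (conjS φ) = conjS (negS (𝓕 φ)) := by
  ext ξ
  rw [conjS_apply, negS_apply]
  change 𝓕 (conjS φ : E → ℂ) ξ = starRingEnd ℂ (𝓕 (φ : E → ℂ) (-ξ))
  rw [Real.fourier_eq', Real.fourier_eq', ← integral_conj]
  refine integral_congr_ae (Eventually.of_forall fun v => ?_)
  simp only [conjS_apply, smul_eq_mul, map_mul, ← Complex.exp_conj, Complex.conj_I,
    Complex.conj_ofReal, inner_neg_right]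
  congr 2
  push_cast
  ring

theorem fourierInv_eq_negS (φ : 𝓢(E, ℂ)) : 𝓕⁻ φ = negS (𝓕 φ) := by
  ext ξ
  rw [SchwartzMap.fourierInv_coe]
  exact Real.fourierInv_eq_fourier_neg (φ : E → ℂ) ξ

theorem fourierInv_eq_conjS (φ : 𝓢(E, ℂ)) : 𝓕⁻ φ = conjS (𝓕 (conjS φ)) := by
  rw [fourier_conjS, conjS_conjS, fourierInv_eq_negS]

/-- A tempered distribution given by a real function commutes with conjugation. -/
theorem IsGivenBy.map_conjS {T : 𝓢'(E, ℂ)} {u : E → ℝ} (h : IsGivenBy T u) (φ : 𝓢(E, ℂ)) :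
    T (conjS φ) = starRingEnd ℂ (T φ) := by
  have h1 : Continuous fun φ => T (conjS φ) := T.continuous.comp conjS.continuous
  have h2 : Continuous fun φ => starRingEnd ℂ (T φ) := Complex.continuous_conj.comp T.continuous
  refine congrFun (Continuous.ext_on dense_hasCompactSupport h1 h2 fun φ hφ => ?_) φ
  rw [Set.mem_ofPred_eq] at hφ
  rw [h.2 φ hφ, h.2 _ (hasCompactSupport_conjS hφ), ← integral_conj]
  simp [conjS_apply]

/-- A real tempered distribution with real Fourier transform is even. -/
theorem IsGivenBy.map_negS {T : 𝓢'(E, ℂ)} {u v : E → ℝ} (h : IsGivenBy T u)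
    (h' : IsGivenBy (𝓕 T) v) (ψ : 𝓢(E, ℂ)) : T (negS ψ) = T ψ := by
  obtain ⟨φ, rfl⟩ : ∃ φ : 𝓢(E, ℂ), 𝓕 φ = ψ := ⟨𝓕⁻ ψ, FourierTransform.fourier_fourierInv_eq ψ⟩
  -- Reality of `𝓕 T` and reality of `T` each pull out a conjugation; what remains of
  -- `fourier_conjS` is the reflection.
  have h1 := h'.map_conjS φ
  rw [TemperedDistribution.fourier_apply, TemperedDistribution.fourier_apply, fourier_conjS,
    h.map_conjS] at h1
  exact (starRingEnd ℂ).injective h1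

end Symmetry

/-! ### Convolutions with compactly supported functions and their Fourier transforms. -/

section Convolution

open Filter Topology ContinuousLinearMap

variable {n : ℕ}

local notation "E" => EuclideanSpace ℝ (Fin n)

theorem locallyIntegrable_ofReal {u : E → ℝ} (h : LocallyIntegrable u volume) :
    LocallyIntegrable (fun x => (u x : ℂ)) volume := fun x => by
  obtain ⟨s, hs, hi⟩ := h x
  exact ⟨s, hs, Integrable.ofReal hi⟩

theorem IsGivenBy.conv_apply {T : 𝓢'(E, ℂ)} {u : E → ℝ} (h : IsGivenBy T u) {f : 𝓢(E, ℂ)}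
    (hf : HasCompactSupport f) (x : E) : conv T f x = ∫ y, (u y : ℂ) * f (x - y) := by
  rw [conv, h.2 _ (hasCompactSupport_reflectAt hf x)]
  simp only [reflectAt_apply]

theorem IsGivenBy.continuous_conv {T : 𝓢'(E, ℂ)} {u : E → ℝ} (h : IsGivenBy T u) {f : 𝓢(E, ℂ)}
    (hf : HasCompactSupport f) : Continuous (conv T f) := by
  have := hf.continuous_convolution_right (mul ℂ ℂ) (locallyIntegrable_ofReal h.1) f.continuous
    (μ := volume)
  convert this using 1
  funext x
  rw [h.conv_apply hf, convolution_def]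
  rfl

theorem IsGivenBy.conv_conjS {T : 𝓢'(E, ℂ)} {u : E → ℝ} (h : IsGivenBy T u) (f : 𝓢(E, ℂ)) (x : E) :
    conv T (conjS f) x = starRingEnd ℂ (conv T f x) := by
  rw [conv, conv, ← h.map_conjS]
  congr 1

/-- The integrand vanishes unless `p.2` lies in the compact set `tsupport φ - tsupport f`, where `u`
is integrable, while `f` is bounded. This licenses Fubini in `IsGivenBy.integral_conv_mul`. -/
theorem integrable_mul_conv_integrand {u : E → ℂ} (hu : LocallyIntegrable u volume)
    {f φ : 𝓢(E, ℂ)} (hf : HasCompactSupport f) (hφ : HasCompactSupport φ) :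
    Integrable (fun p : E × E => u p.2 * f (p.1 - p.2) * φ p.1) (volume.prod volume) := by
  let B : Set E := (fun p : E × E => p.1 - p.2) '' (tsupport φ ×ˢ tsupport f)
  have hB : IsCompact B := (hφ.isCompact.prod hf.isCompact).image (by fun_prop)
  have h1 : Integrable (B.indicator u) volume :=
    (hu.integrableOn_isCompact hB).integrable_indicator hB.measurableSet
  have h2 : Integrable (fun p : E × E => φ p.1 * B.indicator u p.2) (volume.prod volume) :=
    φ.integrable.mul_prod h1
  have h3 := h2.bdd_mul (c := SchwartzMap.seminorm ℝ 0 0 f)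
    (f := fun p : E × E => f (p.1 - p.2))
    (by
      refine Continuous.aestronglyMeasurable ?_
      have := f.continuous
      fun_prop)
    (Eventually.of_forall fun p => f.norm_le_seminorm ℝ _)
  refine h3.congr (Eventually.of_forall fun p => ?_)
  simp only
  by_cases h : p.2 ∈ B
  · rw [Set.indicator_of_mem h]; ring
  · rw [Set.indicator_of_notMem h]
    have : f (p.1 - p.2) = 0 ∨ φ p.1 = 0 := by
      by_contra hc
      push Not at hc
      exact h ⟨(p.1, p.1 - p.2), ⟨subset_tsupport _ hc.2, subset_tsupport _ hc.1⟩, by simp⟩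
    rcases this with h | h <;> simp [h]

/-- The convolution `f ∗ φ` of Schwartz functions. -/
noncomputable def convS (f φ : 𝓢(E, ℂ)) : 𝓢(E, ℂ) := SchwartzMap.convolution (mul ℂ ℂ) f φ

theorem convS_eq (f φ : 𝓢(E, ℂ)) :
    (convS f φ : E → ℂ) = MeasureTheory.convolution f φ (mul ℂ ℂ) volume :=
  funext fun x => SchwartzMap.convolution_apply (mul ℂ ℂ) f φ x

theorem hasCompactSupport_convS {f φ : 𝓢(E, ℂ)} (hf : HasCompactSupport f)
    (hφ : HasCompactSupport φ) : HasCompactSupport (convS f φ) := by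
  rw [convS_eq]
  exact HasCompactSupport.convolution _ hf hφ

theorem convS_negS_apply (f φ : 𝓢(E, ℂ)) (y : E) :
    convS (negS f) φ y = ∫ x, f (x - y) * φ x := by
  rw [convS_eq, convolution_def, ← integral_sub_left_eq_self _ volume y]
  simp [negS_apply]

theorem fourierInv_convS (f φ : 𝓢(E, ℂ)) (ξ : E) : 𝓕⁻ (convS f φ) ξ = 𝓕⁻ f ξ * 𝓕⁻ φ ξ := by
  simp only [fourierInv_eq_negS, negS_apply, convS, SchwartzMap.fourier_convolution,
    SchwartzMap.pairing_apply_apply, mul_apply']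

/-- Multiplication by a Schwartz function. -/
noncomputable def mulS (f : 𝓢(E, ℂ)) : 𝓢(E, ℂ) →L[ℂ] 𝓢(E, ℂ) := SchwartzMap.pairing (mul ℂ ℂ) f

theorem mulS_apply (f φ : 𝓢(E, ℂ)) (x : E) : mulS f φ x = f x * φ x := rfl

theorem hasCompactSupport_mulS (f : 𝓢(E, ℂ)) {φ : 𝓢(E, ℂ)} (hφ : HasCompactSupport φ) :
    HasCompactSupport (mulS f φ) :=
  HasCompactSupport.mul_left (f := (f : E → ℂ)) hφ

/-- Testing `T ∗ f` against `φ` on the Fourier side. -/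
theorem IsGivenBy.integral_conv_mul {T : 𝓢'(E, ℂ)} {u : E → ℝ} (h : IsGivenBy T u)
    {f φ : 𝓢(E, ℂ)} (hf : HasCompactSupport f) (hφ : HasCompactSupport φ) :
    ∫ x, conv T f x * φ x = (𝓕 T) (mulS (𝓕 f) (𝓕⁻ φ)) := by
  have h1 : mulS (𝓕 f) (𝓕⁻ φ) = 𝓕⁻ (convS (negS f) φ) := by
    ext ξ
    rw [fourierInv_convS, mulS_apply]
    congr 1
    rw [fourierInv_eq_negS, negS_apply]
    change 𝓕 (f : E → ℂ) ξ = 𝓕 (negS f : E → ℂ) (-ξ)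
    rw [Real.fourier_eq, Real.fourier_eq, ← integral_neg_eq_self]
    simp [negS_apply]
  rw [h1, TemperedDistribution.fourier_apply, FourierTransform.fourier_fourierInv_eq,
    h.2 _ (hasCompactSupport_convS (hasCompactSupport_negS hf) hφ)]
  have h2 := integral_integral_swap (f := fun x y => (u y : ℂ) * f (x - y) * φ x)
    (integrable_mul_conv_integrand (locallyIntegrable_ofReal h.1) hf hφ)
  calc _ = ∫ x, ∫ y, (u y : ℂ) * f (x - y) * φ x := by
        refine integral_congr_ae (Eventually.of_forall fun x => ?_)
        simp only
        rw [h.conv_apply hf, integral_mul_const]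
    _ = ∫ y, ∫ x, (u y : ℂ) * f (x - y) * φ x := h2
    _ = _ := by
        refine integral_congr_ae (Eventually.of_forall fun y => ?_)
        simp only
        rw [convS_negS_apply, ← integral_const_mul]
        simp only [mul_assoc]

/-- Evenness of `T` turns the correlation appearing in `IsConvolution` into a genuine convolution.
-/
theorem IsGivenBy.integral_sub_mul {T : 𝓢'(E, ℂ)} {u v : E → ℝ} (h : IsGivenBy T u)
    (h' : IsGivenBy (𝓕 T) v) {φ : 𝓢(E, ℂ)} (hφ : HasCompactSupport φ) (y : E) :
    ∫ x, (u (x - y) : ℂ) * φ x = conv T φ y := by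
  have hc := hasCompactSupport_negS (hasCompactSupport_reflectAt hφ y)
  rw [conv, ← h.map_negS h', h.2 _ hc, ← integral_add_right_eq_self _ y]
  refine integral_congr_ae (Eventually.of_forall fun z => ?_)
  simp [negS_apply, reflectAt_apply, add_comm]

/-- If `T ∗ f` is square integrable then its Fourier transform is the product of those of
`T` and `f`. -/
theorem IsGivenBy.fourier_conv_ae_eq {T : 𝓢'(E, ℂ)} {u v : E → ℝ} (h : IsGivenBy T u)
    (h' : IsGivenBy (𝓕 T) v) {f : 𝓢(E, ℂ)} (hf : HasCompactSupport f)
    (hu : MemLp (conv T f) 2 volume) :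
    (𝓕 hu.toLp : Lp ℂ 2 (volume : Measure E)) =ᵐ[volume] fun ξ => (v ξ : ℂ) * 𝓕 f ξ := by
  -- The pairing formula needs `φ` compactly supported, whereas comparing the two functions needs
  -- `𝓕⁻ φ` compactly supported. Density and continuity bridge the two.
  have key : ∀ φ : 𝓢(E, ℂ), (𝓕 T) (mulS (𝓕 f) (𝓕⁻ φ)) = (Lp.toTemperedDistribution hu.toLp) φ := by
    intro φ
    have h1 : Continuous fun φ : 𝓢(E, ℂ) => (𝓕 T) (mulS (𝓕 f) (𝓕⁻ φ)) :=
      (𝓕 T).continuous.comp ((mulS (𝓕 f)).continuous.comp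
        (FourierTransform.fourierInvCLM ℂ 𝓢(E, ℂ)).continuous)
    refine congrFun (Continuous.ext_on dense_hasCompactSupport h1
      (Lp.toTemperedDistribution hu.toLp).continuous fun φ hφ => ?_) φ
    rw [Set.mem_ofPred_eq] at hφ
    rw [← h.integral_conv_mul hf hφ]
    refine Eq.trans (integral_congr_ae ?_) (Lp.toTemperedDistribution_apply hu.toLp φ).symm
    filter_upwards [hu.coeFn_toLp] with x hx
    rw [hx, smul_eq_mul, mul_comm]
  refine ae_eq_of_integral_mul_eq ((Lp.memLp _).locallyIntegrable (by norm_num)) ?_ fun ψ hψ => ?_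
  · exact (locallyIntegrable_ofReal h'.1).smul_continuous (𝓕 f).continuous
  · have h1 := key (𝓕 ψ)
    rw [FourierTransform.fourierInv_fourier_eq, ← TemperedDistribution.fourier_apply,
      Lp.fourier_toTemperedDistribution_eq, Lp.toTemperedDistribution_apply, h'.2] at h1
    · simp only [smul_eq_mul, mul_comm (ψ _)] at h1
      rw [← h1]
      simp only [mulS_apply, mul_assoc]
    · exact hasCompactSupport_mulS _ hψ

end Convolution

/-! ### The index law as multiplicativity of the Fourier transforms. -/

section IndexLaw

open Filter Topology

variable {n : ℕ}

local notation "E" => EuclideanSpace ℝ (Fin n)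

/-- For `v` in the support of `g` the phase `2π⟪v, ξ⟫` stays within `[-π/2, π/2]`, so the cosine is
nonnegative and the real part of the transform is strictly positive. -/
theorem fourier_ne_zero_of_nonneg {g : E → ℝ} (hg : Continuous g) (hgs : HasCompactSupport g)
    (hg0 : ∀ x, 0 ≤ g x) (hg1 : g 0 ≠ 0) {r δ : ℝ} (hδ : 0 ≤ δ) (hδr : δ * r ≤ 1 / 4)
    (hgδ : ∀ x, δ ≤ ‖x‖ → g x = 0) {ξ : E} (hξ : ‖ξ‖ ≤ r) : 𝓕 (fun x => (g x : ℂ)) ξ ≠ 0 := by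
  intro h1
  rw [Real.fourier_eq'] at h1
  have h2 : 0 < ∫ v, Real.cos (-2 * Real.pi * ⟪v, ξ⟫_ℝ) * g v := by
    refine Continuous.integral_pos_of_hasCompactSupport_nonneg_nonzero (x := 0) (by fun_prop)
      hgs.mul_left (fun v => ?_) (by simpa using hg1)
    by_cases hv : ‖v‖ < δ
    · refine mul_nonneg (Real.cos_nonneg_of_mem_Icc (abs_le.mp ?_)) (hg0 v)
      have h3 : |⟪v, ξ⟫_ℝ| ≤ 1 / 4 :=
        ((abs_real_inner_le_norm v ξ).trans (mul_le_mul hv.le hξ (norm_nonneg _) hδ)).trans hδr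
      rw [abs_mul, abs_mul, abs_of_pos Real.pi_pos, abs_neg, abs_two]
      nlinarith [Real.pi_pos]
    · simp [hgδ v (not_lt.mp hv)]
  have hint : Integrable (fun v : E =>
      Complex.exp ((↑(-2 * Real.pi * ⟪v, ξ⟫_ℝ) * Complex.I)) • (g v : ℂ)) volume :=
    Continuous.integrable_of_hasCompactSupport (by fun_prop)
      (hgs.mono fun v hv h => hv (by simp only [h, Complex.ofReal_zero, smul_zero]))
  have h5 := Complex.reCLM.integral_comp_comm hint
  simp only [Complex.reCLM_apply, smul_eq_mul, Complex.re_mul_ofReal,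
    Complex.exp_ofReal_mul_I_re] at h5
  simp only [smul_eq_mul] at h1
  rw [h5, h1] at h2
  simp at h2

theorem exists_schwartz_eq_ofReal {g : E → ℝ} (hg : ContDiff ℝ ((⊤ : ℕ∞) : WithTop ℕ∞) g)
    (hgs : HasCompactSupport g) : ∃ f : 𝓢(E, ℂ), (f : E → ℂ) = fun x => (g x : ℂ) :=
  have hcs : HasCompactSupport (fun x => (g x : ℂ)) := hgs.comp_left Complex.ofReal_zero
  ⟨hcs.toSchwartzMap (Complex.ofRealCLM.contDiff.comp hg), rfl⟩

/-- Compactly supported functions whose Fourier transform does not vanish on a given ball. -/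
theorem exists_fourier_ne_zero_on_ball {r : ℝ} (hr : 0 ≤ r) :
    ∃ f : 𝓢(E, ℂ), HasCompactSupport f ∧ ∀ ξ : E, ‖ξ‖ ≤ r → 𝓕 f ξ ≠ 0 := by
  have hδ : 0 < (4 * (r + 1))⁻¹ := by positivity
  let χ : ContDiffBump (0 : E) := ⟨(4 * (r + 1))⁻¹ / 2, (4 * (r + 1))⁻¹, half_pos hδ, half_lt_self hδ⟩
  obtain ⟨f, hf⟩ := exists_schwartz_eq_ofReal χ.contDiff χ.hasCompactSupport
  refine ⟨f, ?_, fun ξ hξ => ?_⟩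
  · rw [hf]
    exact χ.hasCompactSupport.comp_left Complex.ofReal_zero
  · rw [SchwartzMap.fourier_coe, hf]
    refine fourier_ne_zero_of_nonneg χ.continuous χ.hasCompactSupport (fun _ => χ.nonneg) ?_ hδ.le
      ?_ (fun x hx => χ.zero_of_le_dist (by rwa [dist_zero_right])) hξ
    · rw [χ.one_of_mem_closedBall (Metric.mem_closedBall_self χ.rIn_pos.le)]
      exact one_ne_zero
    · rw [inv_mul_le_iff₀ (by positivity)]
      linarith

/-- The index law with `β = α` forces `T ∗ f` to be square integrable. -/
theorem IsGivenBy.memLp_conv {T S : 𝓢'(E, ℂ)} {u v : E → ℝ} (h : IsGivenBy T u)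
    (h' : IsGivenBy (𝓕 T) v) (hI : ∀ f : 𝓢(E, ℂ), IsConvolution u (conv T f) (conv S f))
    {f : 𝓢(E, ℂ)} (hf : HasCompactSupport f) : MemLp (conv T f) 2 volume := by
  rw [memLp_two_iff_integrable_sq_norm (h.continuous_conv hf).aestronglyMeasurable]
  -- With this test function the inner integral is the conjugate of `conv T f`.
  have h1 := (hI f (conjS f) (hasCompactSupport_conjS hf)).1
  refine h1.norm.congr (Eventually.of_forall fun y => ?_)
  simp only
  rw [h.integral_sub_mul h' (hasCompactSupport_conjS hf), h.conv_conjS, norm_mul, RCLike.norm_conj,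
    sq]

section

variable {Tα Tβ Tγ : 𝓢'(EuclideanSpace ℝ (Fin n), ℂ)}
  {uα uβ uγ vα vβ vγ : EuclideanSpace ℝ (Fin n) → ℝ}

/-- `𝓕⁻ φ` is the conjugate of the transform of the conjugate of `φ`, so the `L²` statement for `𝓕`
carries over. -/
theorem memLp_mul_fourierInv (hα : IsGivenBy Tα uα) (hα' : IsGivenBy (𝓕 Tα) vα)
    (mα : ∀ f : 𝓢(E, ℂ), HasCompactSupport f → MemLp (conv Tα f) 2 volume)
    {φ : 𝓢(E, ℂ)} (hφ : HasCompactSupport φ) :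
    MemLp (fun ξ => (vα ξ : ℂ) * 𝓕⁻ φ ξ) 2 volume := by
  have hφ' := hasCompactSupport_conjS hφ
  have := ((memLp_congr_ae (hα.fourier_conv_ae_eq hα' hφ' (mα _ hφ'))).mp (Lp.memLp _)).star
  refine (memLp_congr_ae (Eventually.of_forall fun ξ => ?_)).mp this
  simp [fourierInv_eq_conjS, conjS_apply]

theorem integrable_mul_mul_fourier (hα : IsGivenBy Tα uα) (hα' : IsGivenBy (𝓕 Tα) vα)
    (hβ : IsGivenBy Tβ uβ) (hβ' : IsGivenBy (𝓕 Tβ) vβ)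
    (mα : ∀ f : 𝓢(E, ℂ), HasCompactSupport f → MemLp (conv Tα f) 2 volume)
    (mβ : ∀ f : 𝓢(E, ℂ), HasCompactSupport f → MemLp (conv Tβ f) 2 volume)
    {f φ : 𝓢(E, ℂ)} (hf : HasCompactSupport f) (hφ : HasCompactSupport φ) :
    Integrable (fun ξ => (vα ξ * vβ ξ : ℂ) * (𝓕 f ξ * 𝓕⁻ φ ξ)) volume := by
  have h1 := (memLp_congr_ae (hβ.fourier_conv_ae_eq hβ' hf (mβ _ hf))).mp (Lp.memLp _)
  refine ((memLp_mul_fourierInv hα hα' mα hφ).integrable_mul h1).congr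
    (Eventually.of_forall fun ξ => ?_)
  simp only [Pi.mul_apply]
  ring

/-- The index law on the Fourier side, by Plancherel. -/
theorem fourier_apply_mulS_eq_integral (hα : IsGivenBy Tα uα) (hα' : IsGivenBy (𝓕 Tα) vα)
    (hβ : IsGivenBy Tβ uβ) (hβ' : IsGivenBy (𝓕 Tβ) vβ) (hγ : IsGivenBy Tγ uγ)
    (mα : ∀ f : 𝓢(E, ℂ), HasCompactSupport f → MemLp (conv Tα f) 2 volume)
    (mβ : ∀ f : 𝓢(E, ℂ), HasCompactSupport f → MemLp (conv Tβ f) 2 volume)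
    (hI : ∀ f : 𝓢(E, ℂ), IsConvolution uα (conv Tβ f) (conv Tγ f))
    {f φ : 𝓢(E, ℂ)} (hf : HasCompactSupport f) (hφ : HasCompactSupport φ) :
    (𝓕 Tγ) (mulS (𝓕 f) (𝓕⁻ φ)) = ∫ ξ, (vα ξ * vβ ξ : ℂ) * (𝓕 f ξ * 𝓕⁻ φ ξ) := by
  have hφ' := hasCompactSupport_conjS hφ
  rw [← hγ.integral_conv_mul hf hφ, ← (hI f φ hφ).2.2]
  -- The inner product is conjugate-linear in its first slot, hence the conjugate of `φ` there.
  have h1 := Lp.inner_fourier_eq (mα _ hφ').toLp (mβ _ hf).toLp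
  rw [L2.inner_def, L2.inner_def] at h1
  calc _ = ∫ x, inner ℂ ((mα _ hφ').toLp _ x) ((mβ _ hf).toLp _ x) := by
        refine integral_congr_ae ?_
        filter_upwards [(mα _ hφ').coeFn_toLp, (mβ _ hf).coeFn_toLp] with x h2 h3
        rw [h2, h3, hα.integral_sub_mul hα' hφ, hα.conv_conjS]
        simp
    _ = _ := h1.symm
    _ = _ := by
        refine integral_congr_ae ?_
        filter_upwards [hα.fourier_conv_ae_eq hα' hφ' (mα _ hφ'),
          hβ.fourier_conv_ae_eq hβ' hf (mβ _ hf)] with x h2 h3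
        rw [h2, h3, fourierInv_eq_conjS, conjS_apply]
        simp
        ring

/-- The integral identity holds only for the special functions `𝓕 f * 𝓕⁻ φ`. Replacing `φ` by `φ ∗
θ` inserts a factor `𝓕⁻ θ`, which density makes arbitrary. Integrability of `G` makes that side
continuous in `θ`. -/
theorem mul_fourier_ae_eq (hα : IsGivenBy Tα uα) (hα' : IsGivenBy (𝓕 Tα) vα)
    (hβ : IsGivenBy Tβ uβ) (hβ' : IsGivenBy (𝓕 Tβ) vβ) (hγ : IsGivenBy Tγ uγ)
    (hγ' : IsGivenBy (𝓕 Tγ) vγ)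
    (mα : ∀ f : 𝓢(E, ℂ), HasCompactSupport f → MemLp (conv Tα f) 2 volume)
    (mβ : ∀ f : 𝓢(E, ℂ), HasCompactSupport f → MemLp (conv Tβ f) 2 volume)
    (hI : ∀ f : 𝓢(E, ℂ), IsConvolution uα (conv Tβ f) (conv Tγ f))
    {f φ : 𝓢(E, ℂ)} (hf : HasCompactSupport f) (hφ : HasCompactSupport φ) :
    (fun ξ => (vγ ξ : ℂ) * (𝓕 f ξ * 𝓕⁻ φ ξ)) =ᵐ[volume]
      fun ξ => (vα ξ * vβ ξ : ℂ) * (𝓕 f ξ * 𝓕⁻ φ ξ) := by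
  have hG := integrable_mul_mul_fourier hα hα' hβ hβ' mα mβ hf hφ
  set G : E → ℂ := fun ξ => (vα ξ * vβ ξ : ℂ) * (𝓕 f ξ * 𝓕⁻ φ ξ) with hGdef
  have hG1 : MemLp G 1 volume := memLp_one_iff_integrable.mpr hG
  have hGint : ∀ ψ : 𝓢(E, ℂ), (Lp.toTemperedDistribution hG1.toLp) ψ = ∫ ξ, G ξ * ψ ξ := by
    intro ψ
    refine (Lp.toTemperedDistribution_apply hG1.toLp ψ).trans (integral_congr_ae ?_)
    filter_upwards [hG1.coeFn_toLp] with x hx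
    rw [hx, smul_eq_mul, mul_comm]
  have key : ∀ θ : 𝓢(E, ℂ), (𝓕 Tγ) (mulS (𝓕 f) (mulS (𝓕⁻ φ) (𝓕⁻ θ))) =
      (Lp.toTemperedDistribution hG1.toLp) (𝓕⁻ θ) := by
    intro θ
    have hF : Continuous fun θ : 𝓢(E, ℂ) => 𝓕⁻ θ :=
      (FourierTransform.fourierInvCLM ℂ 𝓢(E, ℂ)).continuous
    have h1 : Continuous fun θ : 𝓢(E, ℂ) => (𝓕 Tγ) (mulS (𝓕 f) (mulS (𝓕⁻ φ) (𝓕⁻ θ))) :=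
      (𝓕 Tγ).continuous.comp ((mulS (𝓕 f)).continuous.comp ((mulS (𝓕⁻ φ)).continuous.comp hF))
    have h2 : Continuous fun θ : 𝓢(E, ℂ) => (Lp.toTemperedDistribution hG1.toLp) (𝓕⁻ θ) :=
      (Lp.toTemperedDistribution hG1.toLp).continuous.comp hF
    refine congrFun (Continuous.ext_on dense_hasCompactSupport h1 h2 fun θ hθ => ?_) θ
    rw [Set.mem_ofPred_eq] at hθ
    have h3 := fourier_apply_mulS_eq_integral hα hα' hβ hβ' hγ mα mβ hI hf
      (hasCompactSupport_convS hφ hθ)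
    have h4 : 𝓕⁻ (convS φ θ) = mulS (𝓕⁻ φ) (𝓕⁻ θ) := by
      ext ξ
      rw [fourierInv_convS, mulS_apply]
    rw [h4] at h3
    rw [h3, hGint]
    refine integral_congr_ae (Eventually.of_forall fun ξ => ?_)
    simp only [hGdef, mulS_apply]
    ring
  refine ae_eq_of_integral_mul_eq ?_ hG.locallyIntegrable fun ψ hψ => ?_
  · exact (locallyIntegrable_ofReal hγ'.1).smul_continuous
      ((𝓕 f).continuous.mul (𝓕⁻ φ).continuous)
  · have h1 := key (𝓕 ψ)
    rw [FourierTransform.fourierInv_fourier_eq, hGint, hγ'.2] at h1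
    · rw [← h1]
      simp only [mulS_apply, mul_assoc]
    · exact hasCompactSupport_mulS _ (hasCompactSupport_mulS _ hψ)

/-- The Fourier transforms of distributions obeying the index law multiply almost everywhere. -/
theorem ae_eq_mul_of_isConvolution (hα : IsGivenBy Tα uα) (hα' : IsGivenBy (𝓕 Tα) vα)
    (hβ : IsGivenBy Tβ uβ) (hβ' : IsGivenBy (𝓕 Tβ) vβ) (hγ : IsGivenBy Tγ uγ)
    (hγ' : IsGivenBy (𝓕 Tγ) vγ)
    (mα : ∀ f : 𝓢(E, ℂ), HasCompactSupport f → MemLp (conv Tα f) 2 volume)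
    (mβ : ∀ f : 𝓢(E, ℂ), HasCompactSupport f → MemLp (conv Tβ f) 2 volume)
    (hI : ∀ f : 𝓢(E, ℂ), IsConvolution uα (conv Tβ f) (conv Tγ f)) :
    ∀ᵐ ξ, vγ ξ = vα ξ * vβ ξ := by
  -- Countably many test functions suffice, one per ball of radius `k`, so their exceptional sets
  -- form one null set on whose complement the factor can be cancelled.
  choose f hf hf0 using fun k : ℕ => exists_fourier_ne_zero_on_ball (n := n) k.cast_nonneg
  have h := fun k => mul_fourier_ae_eq hα hα' hβ hβ' hγ hγ' mα mβ hI (hf k) (hf k)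
  filter_upwards [ae_all_iff.mpr h] with ξ hξ
  obtain ⟨k, hk⟩ := exists_nat_ge ‖ξ‖
  have h1 : 𝓕 (f k) ξ * 𝓕⁻ (f k) ξ ≠ 0 := by
    refine mul_ne_zero (hf0 k ξ hk) ?_
    rw [fourierInv_eq_negS, negS_apply]
    exact hf0 k (-ξ) (by rwa [norm_neg])
  exact_mod_cast mul_right_cancel₀ h1 (hξ k)

end

end IndexLaw

/-! ### Cauchy's functional equation on a rational subspace. -/

section FunctionalEquation

open Filter Topology

/-- A function on a rational subspace `D` of `ℝ` which is multiplicative on `D ∩ (0, L / 2)`,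
bounded above near some point of `(0, L)`, and takes the value `1` somewhere on `D ∩ (0, L)` is
identically `1` on `D ∩ (0, L)`. -/
theorem eq_one_of_map_add_eq_mul {L : ℝ} {D : Submodule ℚ ℝ} {σ : ℝ → ℝ}
    (hmul : ∀ a ∈ D, ∀ b ∈ D, 0 < a → a < L / 2 → 0 < b → b < L / 2 → σ (a + b) = σ a * σ b)
    {c : ℝ} (hcD : c ∈ D) (hc0 : 0 < c) (hcL : c < L) (hσc : σ c = 1)
    {t : ℝ} (ht0 : 0 < t) (htL : t < L) {δ M : ℝ} (hδ : 0 < δ)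
    (hM : ∀ s ∈ D, |s - t| < δ → σ s ≤ M) :
    ∀ a ∈ D, 0 < a → a < L → σ a = 1 := by
  wlog hδ' : δ ≤ t ∧ δ ≤ L - t generalizing δ
  · exact this (lt_min hδ (lt_min ht0 (sub_pos.mpr htL)))
      (fun s hs h => hM s hs (h.trans_le (min_le_left _ _)))
      ⟨(min_le_right _ _).trans (min_le_left _ _), (min_le_right _ _).trans (min_le_right _ _)⟩
  obtain ⟨hδt, hδL⟩ := hδ'
  have hrat : ∀ (q : ℚ), ∀ a ∈ D, (q : ℝ) * a ∈ D := fun q a ha => by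
    rw [← Rat.smul_def]; exact D.smul_mem q ha
  have hhalf : ∀ k : ℕ, ∀ a ∈ D, a / 2 ^ k ∈ D := fun k a ha => by
    have := hrat (1 / 2 ^ k) a ha
    push_cast at this
    rwa [one_div_mul_eq_div] at this
  have hhalf1 : ∀ a ∈ D, a / 2 ∈ D := fun a ha => by simpa using hhalf 1 a ha
  have hsmall : ∀ a ε : ℝ, 0 < ε → ∃ k : ℕ, a / 2 ^ k < ε := fun a ε hε => by
    obtain ⟨k, hk⟩ := pow_unbounded_of_one_lt (a / ε) one_lt_two
    refine ⟨k, ?_⟩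
    rw [div_lt_iff₀ hε] at hk
    rw [div_lt_iff₀ (by positivity)]
    linarith
  have hsq : ∀ a ∈ D, 0 < a → a < L → σ a = σ (a / 2) ^ 2 := fun a ha h0 hL => by
    have := hmul _ (hhalf1 a ha) _ (hhalf1 a ha) (by linarith) (by linarith) (by linarith)
      (by linarith)
    rwa [add_halves, ← sq] at this
  have hnn : ∀ a ∈ D, 0 < a → a < L → 0 ≤ σ a := fun a ha h0 hL => by
    rw [hsq a ha h0 hL]; positivity
  have hdiv : ∀ (a : ℝ) (k : ℕ), 0 < a → a / 2 ^ k ≤ a := fun a k ha =>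
    div_le_self ha.le (one_le_pow₀ one_le_two)
  have hpow : ∀ k : ℕ, ∀ a ∈ D, 0 < a → a < L → σ a = σ (a / 2 ^ k) ^ 2 ^ k := by
    intro k a ha h0 hL
    induction k with
    | zero => simp
    | succ k ih =>
      rw [ih, hsq _ (hhalf k a ha) (by positivity) ((hdiv a k h0).trans_lt hL), ← pow_mul,
        div_div, ← pow_succ, ← pow_succ']
  have hck : ∀ k : ℕ, σ (c / 2 ^ k) = 1 := by
    intro k
    have h1 := hpow k c hcD hc0 hcL
    rw [hσc] at h1
    exact (pow_eq_one_iff_of_nonneg (hnn _ (hhalf k c hcD) (by positivity)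
      ((hdiv c k hc0).trans_lt hcL)) (by positivity)).mp h1.symm
  have hpos : ∀ a ∈ D, 0 < a → a < L → 0 < σ a := by
    intro a ha h0 hL
    -- The value `σ (c / 2) = 1` factors through `σ (a / 2 ^ k)`, which therefore is nonzero.
    obtain ⟨k, hk⟩ := hsmall a (c / 2) (by linarith)
    have hak : 0 < a / 2 ^ k := by positivity
    have h1 := hmul _ (hhalf k a ha) _ (D.sub_mem (hhalf1 c hcD) (hhalf k a ha)) hak
      (by linarith) (by linarith) (by linarith)
    have h2 := hck 1
    rw [pow_one] at h2
    rw [add_sub_cancel, h2] at h1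
    have h3 : σ (a / 2 ^ k) ≠ 0 := left_ne_zero_of_mul (h1 ▸ one_ne_zero)
    rw [hpow k a ha h0 hL]
    have := (hnn _ (hhalf k a ha) hak ((hdiv a k h0).trans_lt hL)).lt_of_ne' h3
    positivity
  set l : ℝ → ℝ := fun a => Real.log (σ a) with hl
  have hladd : ∀ a ∈ D, ∀ b ∈ D, 0 < a → a < L / 2 → 0 < b → b < L / 2 → l (a + b) = l a + l b :=
    fun a ha b hb h1 h2 h3 h4 => by
      simp only [hl]
      rw [hmul a ha b hb h1 h2 h3 h4, Real.log_mul (hpos a ha h1 (by linarith)).ne'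
        (hpos b hb h3 (by linarith)).ne']
  -- The upper bound near `t` is moved to `t / 2` by doubling, so that additivity, valid only below
  -- `L / 2`, can be used around it.
  have hbd : ∀ s ∈ D, |s - t / 2| < δ / 2 → l s ≤ Real.log M / 2 := by
    intro s hs h
    rw [abs_lt] at h
    have h1 := hladd s hs s hs (by linarith) (by linarith) (by linarith) (by linarith)
    have h2 : l (s + s) ≤ Real.log M :=
      Real.log_le_log (hpos _ (D.add_mem hs hs) (by linarith) (by linarith))
        (hM _ (D.add_mem hs hs) (by rw [abs_lt]; constructor <;> linarith))
    linarith
  -- The point `t` need not lie in `D`, but rational multiples of `c` come arbitrarily close to `t /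
  -- 2`.
  obtain ⟨τ, hτD, hτ⟩ : ∃ τ ∈ D, |τ - t / 2| < δ / 4 := by
    obtain ⟨q, hq1, hq2⟩ := exists_rat_btwn
      (show (t / 2 - δ / 4) / c < (t / 2 + δ / 4) / c by gcongr; linarith)
    rw [div_lt_iff₀ hc0] at hq1
    rw [lt_div_iff₀ hc0] at hq2
    exact ⟨q * c, hrat q c hcD, by rw [abs_lt]; constructor <;> linarith⟩
  rw [abs_lt] at hτ
  -- Upper bounds at `τ + b` and `τ - b` give both an upper and a lower bound for `l b`.
  have hlb : ∀ b ∈ D, 0 < b → b < δ / 4 → |l b| ≤ Real.log M / 2 - l τ := by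
    intro b hb h0 h1
    have h2 := hladd τ hτD b hb (by linarith) (by linarith) h0 (by linarith)
    have h3 := hladd (τ - b) (D.sub_mem hτD hb) b hb (by linarith) (by linarith) h0 (by linarith)
    rw [sub_add_cancel] at h3
    have h4 := hbd (τ + b) (D.add_mem hτD hb) (by rw [abs_lt]; constructor <;> linarith)
    have h5 := hbd (τ - b) (D.sub_mem hτD hb) (by rw [abs_lt]; constructor <;> linarith)
    rw [abs_le]
    constructor <;> linarith
  obtain ⟨k, hk⟩ := hsmall c (δ / 4) (by linarith)
  set e := c / 2 ^ k with he
  have he0 : 0 < e := by positivity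
  have heD : e ∈ D := hhalf k c hcD
  have hle : l e = 0 := by simp only [hl]; rw [hck k, Real.log_one]
  -- Since `l e = 0`, doubling `b` and subtracting `e` if necessary stays in `(0, e]` and doubles `l
  -- b`; each round halves the bound.
  have hlbm : ∀ m : ℕ, ∀ b ∈ D, 0 < b → b < e → |l b| ≤ (Real.log M / 2 - l τ) / 2 ^ m := by
    intro m
    induction m with
    | zero => intro b hb h0 h1; simpa using hlb b hb h0 (h1.trans hk)
    | succ m ih =>
      intro b hb h0 h1
      have h2 := hladd b hb b hb h0 (by linarith) h0 (by linarith)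
      have h3 : |l (b + b)| ≤ (Real.log M / 2 - l τ) / 2 ^ m := by
        rcases lt_trichotomy (b + b) e with h | h | h
        · exact ih _ (D.add_mem hb hb) (by linarith) h
        · rw [h, hle, abs_zero]
          exact (abs_nonneg _).trans (ih b hb h0 h1)
        · have h4 := hladd (b + b - e) (D.sub_mem (D.add_mem hb hb) heD) e heD (by linarith)
            (by linarith) he0 (by linarith)
          rw [sub_add_cancel, hle, add_zero] at h4
          rw [h4]
          exact ih _ (D.sub_mem (D.add_mem hb hb) heD) (by linarith) (by linarith)
      rw [h2, ← two_mul, abs_mul, abs_two] at h3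
      rw [pow_succ, ← div_div, le_div_iff₀ two_pos]
      linarith
  have hone : ∀ b ∈ D, 0 < b → b < e → σ b = 1 := by
    intro b hb h0 h1
    have hlim : Tendsto (fun m : ℕ => (Real.log M / 2 - l τ) / 2 ^ m) atTop (𝓝 0) := by
      have := (tendsto_pow_atTop_nhds_zero_of_lt_one (r := (2 : ℝ)⁻¹) (by norm_num)
        (by norm_num)).const_mul (Real.log M / 2 - l τ)
      simpa [div_eq_mul_inv] using this
    have h2 : |l b| ≤ 0 := ge_of_tendsto' hlim fun m => hlbm m b hb h0 h1
    have h3 : l b = 0 := abs_eq_zero.mp (le_antisymm h2 (abs_nonneg _))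
    rw [← Real.exp_log (hpos b hb h0 (by linarith))]
    simp only [hl] at h3
    rw [h3, Real.exp_zero]
  intro a ha h0 hL
  obtain ⟨j, hj⟩ := hsmall a e he0
  rw [hpow j a ha h0 hL, hone _ (hhalf j a ha) (by positivity) hj, one_pow]

/-- A family of functions of `x` which is multiplicative in the parameter up to null sets, has for
each `x` a point of continuity in the parameter, and equals `c ^ (-α₀)` at one parameter `α₀`,
equals `c ^ (-α)` at every parameter `α`, up to null sets. -/
theorem ae_eq_rpow_neg {X : Type*} [MeasurableSpace X] {μ : Measure X} {L : ℝ} {v : ℝ → X → ℝ}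
    {c : X → ℝ} (hc : ∀ᵐ x ∂μ, 0 < c x)
    (hmul : ∀ a ∈ Set.Ioo 0 (L / 2), ∀ b ∈ Set.Ioo 0 (L / 2),
      ∀ᵐ x ∂μ, v (a + b) x = v a x * v b x)
    {α₀ : ℝ} (hα₀ : α₀ ∈ Set.Ioo 0 L) (hid : ∀ᵐ x ∂μ, v α₀ x = c x ^ (-α₀))
    (hcont : ∀ᵐ x ∂μ, ∃ t ∈ Set.Ioo 0 L, ContinuousAt (fun a => v a x) t)
    {α : ℝ} (hα : α ∈ Set.Ioo 0 L) : ∀ᵐ x ∂μ, v α x = c x ^ (-α) := by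
  -- Its range is the countable group `ℚ α₀ + ℚ α`; quantifying over pairs of rationals keeps the
  -- exceptional set null.
  let f : ℚ × ℚ →ₗ[ℚ] ℝ :=
    (LinearMap.toSpanSingleton ℚ ℝ α₀).coprod (LinearMap.toSpanSingleton ℚ ℝ α)
  have hf : ∀ p, f p = p.1 • α₀ + p.2 • α := fun p => rfl
  have h : ∀ᵐ x ∂μ, ∀ p q : ℚ × ℚ, f p ∈ Set.Ioo 0 (L / 2) → f q ∈ Set.Ioo 0 (L / 2) →
      v (f p + f q) x = v (f p) x * v (f q) x := by
    simp only [ae_all_iff]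
    exact fun p q hp hq => hmul _ hp _ hq
  filter_upwards [hc, h, hid, hcont] with x hcx hx hidx ⟨t, ht, hct⟩
  have hct' : ContinuousAt (fun a => v a x * c x ^ a) t :=
    hct.mul (Real.continuous_const_rpow hcx.ne').continuousAt
  obtain ⟨δ, hδ, hM⟩ := Metric.eventually_nhds_iff.mp
    (hct'.eventually_le_const (lt_add_one (v t x * c x ^ t)))
  have h1 := eq_one_of_map_add_eq_mul (L := L) (D := LinearMap.range f)
    (σ := fun a => v a x * c x ^ a) (c := α₀) ?_ ⟨(1, 0), by simp [hf]⟩ hα₀.1 hα₀.2 ?_ ht.1 ht.2 hδ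
    (fun s _ hs => hM (by rwa [Real.dist_eq])) α ⟨(0, 1), by simp [hf]⟩ hα.1 hα.2
  · rw [Real.rpow_neg hcx.le]
    exact eq_inv_of_mul_eq_one_left h1
  · rintro _ ⟨p, rfl⟩ _ ⟨q, rfl⟩ hp1 hp2 hq1 hq2
    rw [hx p q ⟨hp1, hp2⟩ ⟨hq1, hq2⟩, Real.rpow_add hcx]
    ring
  · rw [hidx, ← Real.rpow_add hcx, neg_add_cancel, Real.rpow_zero]

end FunctionalEquation

/-! ### The Fourier transform of the Riesz kernel. -/

section Riesz

open Filter Topology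

variable {n : ℕ}

local notation "E" => EuclideanSpace ℝ (Fin n)

theorem locallyIntegrable_norm_rpow_neg {a : ℝ} (ha0 : 0 < a) (han : a < n) :
    LocallyIntegrable (fun x : E => ‖x‖ ^ (-a)) volume := by
  have hn : 1 ≤ Module.finrank ℝ E := by
    rw [finrank_euclideanSpace_fin]
    exact_mod_cast ha0.trans han
  refine locallyIntegrable_of_norm_le_rpow (α := a) (C := 1) hn
    (by rwa [finrank_euclideanSpace_fin]) (Eventually.of_forall fun x => ?_)
    (by fun_prop : Measurable fun x : E => ‖x‖ ^ (-a)).aestronglyMeasurable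
  rw [one_mul, Real.norm_of_nonneg (by positivity)]

/-- The kernel `‖x‖ ^ (-a)`, for `0 < a < n`, is integrable against Schwartz functions. -/
theorem integrable_norm_rpow_neg_mul {a : ℝ} (ha0 : 0 < a) (han : a < n) (φ : 𝓢(E, ℂ)) :
    Integrable (fun x : E => ((‖x‖ ^ (-a) : ℝ) : ℂ) * φ x) volume := by
  let B : Set E := Metric.closedBall 0 1
  have hmeas : Measurable fun x : E => ‖x‖ ^ (-a) := by fun_prop
  have h1 : Integrable (B.indicator fun x : E => ‖x‖ ^ (-a)) volume :=
    ((locallyIntegrable_norm_rpow_neg ha0 han).integrableOn_isCompact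
      (isCompact_closedBall 0 1)).integrable_indicator Metric.isClosed_closedBall.measurableSet
  have h2 := (h1.mul_const (SchwartzMap.seminorm ℝ 0 0 φ)).add φ.integrable.norm (μ := volume)
  refine h2.mono' ((Complex.measurable_ofReal.comp hmeas).aestronglyMeasurable.mul
    φ.continuous.aestronglyMeasurable) (Eventually.of_forall fun x => ?_)
  have hx : 0 ≤ ‖x‖ ^ (-a) := by positivity
  rw [norm_mul, Complex.norm_real, Real.norm_of_nonneg hx, Pi.add_apply]
  by_cases h : x ∈ B
  · rw [Set.indicator_of_mem h]
    exact (mul_le_mul_of_nonneg_left (φ.norm_le_seminorm ℝ x) hx).trans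
      (le_add_of_nonneg_right (norm_nonneg _))
  · rw [Set.indicator_of_notMem h, zero_mul, zero_add]
    have : 1 ≤ ‖x‖ := by
      rw [Metric.mem_closedBall, dist_zero_right] at h
      exact (not_le.mp h).le
    exact mul_le_of_le_one_left (norm_nonneg _)
      (Real.rpow_le_one_of_one_le_of_nonpos this (by linarith))

theorem integral_rpow_mul_exp_neg_pi_mul_sq {a r : ℝ} (ha : 0 < a) (hr : 0 < r) :
    ∫ t in Set.Ioi (0 : ℝ), t ^ (a / 2 - 1) * Real.exp (-(Real.pi * r ^ 2 * t)) =
      Real.Gamma (a / 2) * Real.pi ^ (-(a / 2)) * r ^ (-a) := by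
  have hpi := Real.pi_pos
  rw [Real.integral_rpow_mul_exp_neg_mul_Ioi (by positivity) (by positivity), one_div,
    Real.inv_rpow (by positivity), ← Real.rpow_neg (by positivity),
    Real.mul_rpow hpi.le (by positivity), ← Real.rpow_natCast r 2, ← Real.rpow_mul hr.le]
  have : ((2 : ℕ) : ℝ) * -(a / 2) = -a := by push_cast; ring
  rw [this]
  ring

/-- The Gaussian integral `∫ e^{-π t ‖x‖²} φ(x) dx`. -/
noncomputable def gaussInt (φ : 𝓢(E, ℂ)) (t : ℝ) : ℂ :=
  ∫ x : E, (Real.exp (-(Real.pi * ‖x‖ ^ 2 * t)) : ℂ) * φ x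

theorem integrable_gaussian_prod {a : ℝ} (ha0 : 0 < a) (han : a < n) (φ : 𝓢(E, ℂ)) :
    Integrable (fun p : ℝ × E =>
      ((p.1 ^ (a / 2 - 1) * Real.exp (-(Real.pi * ‖p.2‖ ^ 2 * p.1)) : ℝ) : ℂ) * φ p.2)
      ((volume.restrict (Set.Ioi 0)).prod volume) := by
  have hn : 0 < n := by exact_mod_cast ha0.trans han
  have : Nonempty (Fin n) := ⟨⟨0, hn⟩⟩
  have hne : ∀ᵐ x : E, x ≠ 0 := Measure.ae_ne volume 0
  have hmeas : Measurable fun p : ℝ × E =>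
      ((p.1 ^ (a / 2 - 1) * Real.exp (-(Real.pi * ‖p.2‖ ^ 2 * p.1)) : ℝ) : ℂ) * φ p.2 := by
    have := φ.continuous.measurable
    fun_prop
  have hint : ∀ x : E, x ≠ 0 → Integrable (fun t : ℝ =>
      t ^ (a / 2 - 1) * Real.exp (-(Real.pi * ‖x‖ ^ 2 * t))) (volume.restrict (Set.Ioi 0)) := by
    intro x hx
    have hx' := norm_pos_iff.mpr hx
    -- The integral of a non-integrable function is `0` by convention, so the positive Gamma value
    -- proves integrability.
    refine Integrable.of_integral_ne_zero ?_
    rw [integral_rpow_mul_exp_neg_pi_mul_sq ha0 hx']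
    have := Real.Gamma_pos_of_pos (half_pos ha0)
    positivity
  rw [integrable_prod_iff' hmeas.aestronglyMeasurable]
  refine ⟨?_, ?_⟩
  · filter_upwards [hne] with x hx
    exact (hint x hx).ofReal.mul_const _
  · refine ((integrable_norm_rpow_neg_mul ha0 han φ).norm.const_mul
      (Real.Gamma (a / 2) * Real.pi ^ (-(a / 2)))).congr ?_
    filter_upwards [hne] with x hx
    have hx' := norm_pos_iff.mpr hx
    rw [norm_mul, Complex.norm_real, Real.norm_of_nonneg (by positivity), ← mul_assoc,
      ← integral_rpow_mul_exp_neg_pi_mul_sq ha0 hx', ← integral_mul_const]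
    refine setIntegral_congr_fun measurableSet_Ioi fun t (ht : 0 < t) => ?_
    rw [norm_mul, Complex.norm_real, Real.norm_of_nonneg (by positivity)]

/-- Subordination of the kernel `‖x‖ ^ (-a)` to Gaussians. -/
theorem integral_rpow_mul_gaussInt {a : ℝ} (ha0 : 0 < a) (han : a < n) (φ : 𝓢(E, ℂ)) :
    ∫ t in Set.Ioi (0 : ℝ), ((t ^ (a / 2 - 1) : ℝ) : ℂ) * gaussInt φ t =
      ((Real.Gamma (a / 2) * Real.pi ^ (-(a / 2)) : ℝ) : ℂ) *
        ∫ x : E, ((‖x‖ ^ (-a) : ℝ) : ℂ) * φ x := by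
  have hn : 0 < n := by exact_mod_cast ha0.trans han
  have : Nonempty (Fin n) := ⟨⟨0, hn⟩⟩
  have hswap := integral_integral_swap (f := fun (t : ℝ) (x : E) =>
      ((t ^ (a / 2 - 1) * Real.exp (-(Real.pi * ‖x‖ ^ 2 * t)) : ℝ) : ℂ) * φ x)
    (integrable_gaussian_prod ha0 han φ)
  calc _ = ∫ t in Set.Ioi (0 : ℝ), ∫ x : E,
        ((t ^ (a / 2 - 1) * Real.exp (-(Real.pi * ‖x‖ ^ 2 * t)) : ℝ) : ℂ) * φ x := by
        congr 1
        funext t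
        rw [gaussInt, ← integral_const_mul]
        congr 1
        funext x
        push_cast
        ring
    _ = _ := hswap
    _ = _ := by
        rw [← integral_const_mul]
        refine integral_congr_ae ?_
        filter_upwards [Measure.ae_ne volume (0 : E)] with x hx
        rw [integral_mul_const, integral_complex_ofReal,
          integral_rpow_mul_exp_neg_pi_mul_sq ha0 (norm_pos_iff.mpr hx)]
        push_cast
        ring

/-- This is the multiplication formula `∫ G * 𝓕 φ = ∫ 𝓕 G * φ` with `G` a Gaussian; evenness of `G`
allows `𝓕⁻` in place of `𝓕`. -/
theorem gaussInt_fourierInv (φ : 𝓢(E, ℂ)) {t : ℝ} (ht : 0 < t) :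
    gaussInt (𝓕⁻ φ) t = ((t ^ (-((n : ℝ) / 2)) : ℝ) : ℂ) * gaussInt φ t⁻¹ := by
  have hpi := Real.pi_pos
  have hb : 0 < ((Real.pi * t : ℝ) : ℂ).re := by rw [Complex.ofReal_re]; positivity
  let G : E → ℂ := fun v => Complex.exp (-((Real.pi * t : ℝ) : ℂ) * ‖v‖ ^ 2)
  have hG : ∀ x, (Real.exp (-(Real.pi * ‖x‖ ^ 2 * t)) : ℂ) = G x := fun x => by
    simp only [G]
    push_cast
    congr 1
    ring
  have hGi : Integrable G volume := by
    have := GaussianFourier.integrable_cexp_neg_mul_sq_norm_add hb 0 (0 : E)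
    simpa [G] using this
  have h1 := VectorFourier.integral_bilin_fourierIntegral_eq_flip (ContinuousLinearMap.mul ℂ ℂ)
    (L := innerₗ E) Real.continuous_fourierChar continuous_inner hGi (φ.integrable (μ := volume))
  have hGF : ∀ w, 𝓕 G w = ((t ^ (-((n : ℝ) / 2)) : ℝ) : ℂ) *
      (Real.exp (-(Real.pi * ‖w‖ ^ 2 * t⁻¹)) : ℂ) := fun w => by
    rw [fourier_gaussian_innerProductSpace hb w, finrank_euclideanSpace_fin]
    congr 1
    · have : ((Real.pi : ℂ) / ((Real.pi * t : ℝ) : ℂ)) = ((t⁻¹ : ℝ) : ℂ) := by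
        push_cast
        field_simp
      rw [this, Real.rpow_neg ht.le, ← Real.inv_rpow ht.le, Complex.ofReal_cpow (by positivity)]
      push_cast
      rfl
    · push_cast
      congr 1
      have : (t : ℂ) ≠ 0 := by exact_mod_cast ht.ne'
      field_simp
  calc gaussInt (𝓕⁻ φ) t = ∫ x, G x * 𝓕 φ x := by
        rw [gaussInt, ← integral_neg_eq_self]
        simp only [fourierInv_eq_negS, negS_apply, norm_neg, neg_neg, hG]
    _ = ∫ x, 𝓕 G x * φ x := by
        simpa using! h1.symm
    _ = _ := by
        rw [gaussInt, ← integral_const_mul]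
        simp only [hGF, mul_assoc]

/-- The Fourier transform of the kernel `‖ξ‖ ^ (-α)`. -/
theorem integral_norm_rpow_neg_mul_fourierInv {α : ℝ} (h0 : 0 < α) (hn : α < n) (φ : 𝓢(E, ℂ)) :
    ((Real.Gamma (α / 2) * Real.pi ^ (-(α / 2)) : ℝ) : ℂ) *
        ∫ ξ : E, ((‖ξ‖ ^ (-α) : ℝ) : ℂ) * 𝓕⁻ φ ξ =
      ((Real.Gamma ((n - α) / 2) * Real.pi ^ (-((n - α) / 2)) : ℝ) : ℂ) *
        ∫ x : E, ((‖x‖ ^ (-(n - α)) : ℝ) : ℂ) * φ x := by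
  -- The substitution `t ↦ t⁻¹`, with the factor from `gaussInt_fourierInv`, exchanges the exponents
  -- `α / 2` and `(n - α) / 2`.
  rw [← integral_rpow_mul_gaussInt h0 hn, ← integral_rpow_mul_gaussInt (by linarith) (by linarith),
    ← integral_comp_rpow_Ioi _ (neg_ne_zero.mpr one_ne_zero)]
  refine setIntegral_congr_fun measurableSet_Ioi fun t (ht : 0 < t) => ?_
  rw [Real.rpow_neg_one, gaussInt_fourierInv φ (inv_pos.mpr ht), inv_inv, abs_neg, abs_one, one_mul,
    Complex.real_smul, ← mul_assoc, ← mul_assoc, ← Complex.ofReal_mul, ← Complex.ofReal_mul,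
    Real.inv_rpow ht.le, Real.inv_rpow ht.le, ← Real.rpow_neg ht.le, ← Real.rpow_neg ht.le,
    ← Real.rpow_add ht, ← Real.rpow_add ht]
  congr 3
  ring

/-- A tempered distribution whose Fourier transform is `‖ξ‖ ^ (-α)` is the Riesz kernel. -/
theorem apply_eq_rieszConst_inv_mul_integral {T : 𝓢'(E, ℂ)} {v : E → ℝ} (h : IsGivenBy (𝓕 T) v)
    {α : ℝ} (h0 : 0 < α) (hn : α < n)
    (hv : ∀ᵐ ξ, v ξ = ‖(2 * Real.pi) • ξ‖ ^ (-α)) (φ : 𝓢(E, ℂ)) :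
    T φ = ((rieszConst n α)⁻¹ : ℝ) * ∫ x : E, ((‖x‖ ^ (-(n - α)) : ℝ) : ℂ) * φ x := by
  have hpi := Real.pi_pos
  have hv' : (fun ξ => ((2 * Real.pi) ^ (-α) : ℝ) * (((‖ξ‖ ^ (-α) : ℝ) : ℂ) * 𝓕⁻ φ ξ)) =ᵐ[volume]
      fun ξ => (v ξ : ℂ) * 𝓕⁻ φ ξ := by
    filter_upwards [hv] with ξ hξ
    rw [hξ, norm_smul, Real.norm_of_nonneg (by positivity),
      Real.mul_rpow (by positivity) (norm_nonneg _)]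
    push_cast
    ring
  -- `𝓕⁻ φ` need not be compactly supported; integrability of its product with `‖ξ‖ ^ (-α)`
  -- justifies testing against it.
  have h1 : T φ = ∫ ξ, (v ξ : ℂ) * 𝓕⁻ φ ξ := by
    rw [← apply_eq_integral_of_integrable (𝓕 T).continuous
      (locallyIntegrable_ofReal h.1).aestronglyMeasurable h.2 (𝓕⁻ φ)
      (((integrable_norm_rpow_neg_mul h0 hn (𝓕⁻ φ)).const_mul _).congr hv'),
      TemperedDistribution.fourier_apply, FourierTransform.fourier_fourierInv_eq]
  have hΓ1 := Real.Gamma_pos_of_pos (half_pos h0)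
  have hΓ2 : 0 < Real.Gamma ((n - α) / 2) := Real.Gamma_pos_of_pos (by linarith)
  have hc : (rieszConst n α)⁻¹ * (Real.Gamma (α / 2) * Real.pi ^ (-(α / 2))) =
      (2 * Real.pi) ^ (-α) * (Real.Gamma ((n - α) / 2) * Real.pi ^ (-((n - α) / 2))) := by
    have e1 : Real.pi ^ (-(α / 2)) = Real.pi ^ ((n : ℝ) / 2) *
        (Real.pi ^ (-α) * Real.pi ^ (-((n - α) / 2))) := by
      rw [← Real.rpow_add hpi, ← Real.rpow_add hpi]
      congr 1
      ring
    rw [rieszConst, Real.mul_rpow two_pos.le hpi.le, e1, Real.rpow_neg two_pos.le]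
    field_simp
  have hne : ((Real.Gamma (α / 2) * Real.pi ^ (-(α / 2)) : ℝ) : ℂ) ≠ 0 := by
    rw [Complex.ofReal_ne_zero]; positivity
  rw [h1, ← integral_congr_ae hv', integral_const_mul]
  refine mul_left_cancel₀ hne ?_
  have h2 := integral_norm_rpow_neg_mul_fourierInv h0 hn φ
  have hc' := congrArg (fun r : ℝ => (r : ℂ)) hc
  simp only [Complex.ofReal_mul] at hc' h2 ⊢
  linear_combination (((2 * Real.pi) ^ (-α) : ℝ) : ℂ) * h2 -
    (∫ x : E, ((‖x‖ ^ (-(n - α)) : ℝ) : ℂ) * φ x) * hc'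

theorem integrable_div_norm_sub_rpow {α : ℝ} (h0 : 0 < α) (hn : α < n) (f : 𝓢(E, ℂ)) (x : E) :
    Integrable (fun y => f y / ((‖x - y‖ ^ ((n : ℝ) - α) : ℝ) : ℂ)) volume := by
  have h1 := (integrable_norm_rpow_neg_mul (a := n - α) (by linarith) (by linarith)
    (reflectAt f x)).comp_sub_left x
  refine h1.congr (Eventually.of_forall fun y => ?_)
  simp only [reflectAt_apply, sub_sub_cancel]
  rw [Real.rpow_neg (norm_nonneg _), Complex.ofReal_inv, div_eq_inv_mul]

theorem conv_eq_rieszPotential {T : 𝓢'(E, ℂ)} {v : E → ℝ} (h : IsGivenBy (𝓕 T) v)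
    {α : ℝ} (h0 : 0 < α) (hn : α < n)
    (hv : ∀ᵐ ξ, v ξ = ‖(2 * Real.pi) • ξ‖ ^ (-α)) (f : 𝓢(E, ℂ)) (x : E) :
    conv T f x = rieszPotential α f x := by
  rw [conv, apply_eq_rieszConst_inv_mul_integral h h0 hn hv, rieszPotential,
    ← integral_sub_left_eq_self _ volume x]
  congr 1
  refine integral_congr_ae (Eventually.of_forall fun y => ?_)
  simp only [reflectAt_apply, sub_sub_cancel]
  rw [Real.rpow_neg (norm_nonneg _), Complex.ofReal_inv, div_eq_inv_mul]

end Riesz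

end RieszChar

/-! ### The characterization of the Riesz potential. -/

open RieszChar in
theorem mainTheorem10 (n : ℕ)
    (K : ℝ → EuclideanSpace ℝ (Fin n) → ℝ)
    (T : ℝ → 𝓢'(EuclideanSpace ℝ (Fin n), ℂ))
    (R : ℝ → EuclideanSpace ℝ (Fin n) → ℝ)
    -- `K α` is locally integrable and defines the tempered distribution `T α`
    (hK : ∀ α ∈ Set.Ioo (0 : ℝ) n, RieszChar.IsGivenBy (T α) (K α))
    -- the Fourier transform of `K α` is the function `R α`
    (hR : ∀ α ∈ Set.Ioo (0 : ℝ) n, RieszChar.IsGivenBy (RieszChar.hat (T α)) (R α))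
    (identity : ∃ α₀ ∈ Set.Ioo (0 : ℝ) n, ∀ x : EuclideanSpace ℝ (Fin n), x ≠ 0 →
      R α₀ x = 1 / ‖x‖ ^ α₀)
    (index_law : ∀ α ∈ Set.Ioo (0 : ℝ) n, ∀ β ∈ Set.Ioo (0 : ℝ) n, α + β < n →
      ∀ f : 𝓢(EuclideanSpace ℝ (Fin n), ℂ),
        RieszChar.IsConvolution (K α) (RieszChar.conv (T β) f) (RieszChar.conv (T (α + β)) f))
    (continuity : ∀ x : EuclideanSpace ℝ (Fin n), x ≠ 0 →
      ∃ a ∈ Set.Ioo (0 : ℝ) n, ContinuousAt (fun α => R α x) a) :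
    ∀ α ∈ Set.Ioo (0 : ℝ) n, ∀ (f : 𝓢(EuclideanSpace ℝ (Fin n), ℂ))
      (x : EuclideanSpace ℝ (Fin n)),
        Integrable (fun y => f y / ((‖x - y‖ ^ ((n : ℝ) - α) : ℝ) : ℂ)) volume ∧
        RieszChar.conv (T α) f x = RieszChar.rieszPotential α f x := by
  intro α hα f x
  refine ⟨integrable_div_norm_sub_rpow hα.1 hα.2 f x, ?_⟩
  have hn : 0 < n := by exact_mod_cast hα.1.trans hα.2
  have : Nonempty (Fin n) := ⟨⟨0, hn⟩⟩
  have hF := fun a ha => isGivenBy_fourier (hR a ha)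
  have hlt : ∀ a ∈ Set.Ioo (0 : ℝ) (n / 2), a ∈ Set.Ioo (0 : ℝ) n := fun a ha =>
    ⟨ha.1, by linarith [ha.1, ha.2]⟩
  -- The bound `n / 2` is what admits `β = α` in the index law.
  have hL2 : ∀ a ∈ Set.Ioo (0 : ℝ) (n / 2), ∀ f : 𝓢(EuclideanSpace ℝ (Fin n), ℂ),
      HasCompactSupport f → MemLp (conv (T a) f) 2 volume := fun a ha f hf =>
    (hK a (hlt a ha)).memLp_conv (hF a (hlt a ha))
      (index_law a (hlt a ha) a (hlt a ha) (by linarith [ha.2])) hf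
  have hne : ∀ᵐ ξ : EuclideanSpace ℝ (Fin n), (2 * Real.pi) • ξ ≠ 0 := by
    filter_upwards [Measure.ae_ne volume (0 : EuclideanSpace ℝ (Fin n))] with ξ hξ
    exact smul_ne_zero (by positivity) hξ
  obtain ⟨α₀, hα₀, hid⟩ := identity
  refine conv_eq_rieszPotential (hF α hα) hα.1 hα.2 ?_ f x
  refine ae_eq_rpow_neg (v := fun a ξ => R a ((2 * Real.pi) • ξ)) (L := n)
    (hne.mono fun ξ hξ => norm_pos_iff.mpr hξ) (fun a ha b hb => ?_) hα₀
    (hne.mono fun ξ hξ => ?_) (hne.mono fun ξ hξ => continuity _ hξ) hα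
  · have hab : a + b < n := by linarith [ha.2, hb.2]
    have hab' : a + b ∈ Set.Ioo (0 : ℝ) n := ⟨add_pos ha.1 hb.1, hab⟩
    exact ae_eq_mul_of_isConvolution (hK a (hlt a ha)) (hF a (hlt a ha)) (hK b (hlt b hb))
      (hF b (hlt b hb)) (hK _ hab') (hF _ hab') (hL2 a ha) (hL2 b hb)
      (index_law a (hlt a ha) b (hlt b hb) hab)
  · rw [hid _ hξ, Real.rpow_neg (norm_nonneg _), one_div]
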